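/- **Conventions.** Let $L$ be a finitary first-order language. An *abstract elementary class* (AEC) in $L$ is a pair ${\bf K}=\langle K,\le_{\bf K}\rangle$, where $K$ is a class of $L$-structures and $\le_{\bf K}$ is a partial order on $K$, such that: $M\le_{\bf K}N$ implies that $M$ is an $L$-substructure of $N$; $K$ and $\le_{\bf K}$ are closed under isomorphism; (coherence) $M_1\le_{\bf K}M_3$, $M_2\le_{\bf K}M_3$ and $M_1\subseteq M_2$ imply $M_1\le_{\bf K}M_2$; (Löwenheim–Skolem) there is an infinite cardinal $\lambda\ge|L|$ such that for all $M\in K$ and $A\subseteq|M|$ there is $N\le_{\bf K}M$ with $A\subseteq|N|$ and $\|N\|\le\lambda+|A|$; (chains) the union $M$ of a nonempty well-ordered $\le_{\bf K}$-increasing chain $\langle M_i\rangle$ of members of $K$ is in $K$, $M_i\le_{\bf K}M$ for all $i$, and if $M_i\le_{\bf K}N$ for all $i$ then $M\le_{\bf K}N$. The least $\lambda$ as in the Löwenheim–Skolem axiom is denoted $\mathrm{LS}({\bf K})$. As usual, models of size less than $\mathrm{LS}({\bf K})$ are discarded: put $K_{\ge\mathrm{LS}({\bf K})}=\{M\in K:\|M\|\ge\mathrm{LS}({\bf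 K})\}$. Let $I_2(\lambda,{\bf K})$ be the number of pairs $(M,N)$ with $M\le_{\bf K}N$ and $\|M\|=\|N\|=\lambda$, up to isomorphism, where $(M_1,N_1)\cong(M_2,N_2)$ means that some isomorphism $N_1\cong N_2$ carries $M_1$ onto $M_2$. For a language $L'\supseteq L$, a first-order $L'$-theory $T$ and a set $\Gamma$ of $L'$-types (a type is a set of $L'$-formulas in finitely many variables, realized in some model of $T$), let $EC(T,\Gamma)$ be the class of all $L'$-structures that are models of $T$ and omit every member of $\Gamma$, and let $PC(T,\Gamma,L)=\{M'\restriction L: M'\in EC(T,\Gamma)\}$. **Theorem 4.1.** Let ${\bf K}$ be an AEC in $L$ and let $\chi=\mathrm{LS}({\bf K})+I_2(\mathrm{LS}({\bf K}),{\bf K})$. There are a language $L'\supseteq L$ of size $\chi$, a first-order $L'$-theory $T$ and a set $\Gamma$ of exactly $\chi$ many $L'$-types such that: 1. $K_{\ge\mathrm{LS}({\bf K})}=PC(T,\Gamma,L)$. 2. If $M',N'\in EC(T,\Gamma)$ and $M'$ is an $L'$-substructure of $N'$, then $M'\restriction L\le_{\bf K}N'\restriction L$. 3. If $M\le_{\bf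 K}N$ are in $K_{\ge\mathrm{LS}({\bf K})}$, then there are expansions of $M$, $N$ to $L'$-structures $M',N'\in EC(T,\Gamma)$ such that $M'$ is an $L'$-substructure of $N'$. -/

import Mathlib

open Cardinal FirstOrder

universe u

namespace FirstOrder.Language

/-- A class of `L`-structures together with a relation `M ≤_K N`. The relation is only ever
considered between `L`-structures `M ⊆ N`, so it is recorded as a predicate on the pairs
consisting of an `L`-structure `N` and an `L`-substructure `M` of `N`. -/
structure StructureClass (L : Language.{u, u}) where
  /-- `M` belongs to the class `K`. -/
  mem : ∀ (M : Type u) [L.Structure M], Prop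
  /-- For `S` an `L`-substructure of `N`: the structure `S` is a `K`-substructure of `N`. -/
  strong : ∀ {N : Type u} [L.Structure N], L.Substructure N → Prop

namespace StructureClass

variable {L : Language.{u, u}}

/-- For two substructures `S`, `T` of one structure: `S ⊆ T`, and the structure `S` is a
`K`-substructure of the structure `T`. -/
def Le (K : StructureClass L) {N : Type u} [L.Structure N] (S T : L.Substructure N) : Prop :=
  S ≤ T ∧ K.strong (S.comap T.subtype.toHom)

/-- `κ` is an infinite cardinal, at least the size of the language, such that every subset `A` of
a member `M` of `K` is contained in some `K`-substructure of `M` of size at most `κ + |A|`. -/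
def IsLSBound (K : StructureClass L) (κ : Cardinal.{u}) : Prop :=
  ℵ₀ ≤ κ ∧ L.card ≤ κ ∧
    ∀ (M : Type u) [L.Structure M], K.mem M → ∀ A : Set M,
      ∃ S : L.Substructure M, A ⊆ (S : Set M) ∧ K.strong S ∧ #S ≤ κ + #A

end StructureClass

/-- Abstract elementary classes in the finitary language `L`. -/
structure AEC (L : Language.{u, u}) extends StructureClass L where
  /-- `≤_K` is a relation on `K`. -/
  mem_of_strong : ∀ {N : Type u} [L.Structure N] (S : L.Substructure N),
    strong S → mem S ∧ mem N
  /-- `≤_K` is reflexive on `K`. -/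
  strong_refl : ∀ (N : Type u) [L.Structure N], mem N → strong (⊤ : L.Substructure N)
  /-- `≤_K` is transitive. -/
  strong_trans : ∀ {N : Type u} [L.Structure N] (S T : L.Substructure N),
    toStructureClass.Le S T → strong T → strong S
  /-- `K` is closed under isomorphism. -/
  mem_iso : ∀ {M N : Type u} [L.Structure M] [L.Structure N], (M ≃[L] N) → mem M → mem N
  /-- `≤_K` is invariant under isomorphism of pairs. -/
  strong_iso : ∀ {N₁ N₂ : Type u} [L.Structure N₁] [L.Structure N₂] (g : N₁ ≃[L] N₂)
    (S : L.Substructure N₁), strong S → strong (S.map g.toHom)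
  /-- Coherence. -/
  coherence : ∀ {N : Type u} [L.Structure N] (S T : L.Substructure N),
    strong S → strong T → S ≤ T → toStructureClass.Le S T
  /-- The Löwenheim-Skolem axiom. -/
  exists_isLSBound : ∃ κ : Cardinal.{u}, toStructureClass.IsLSBound κ
  /-- First chain axiom: the union `M` of a (nonempty, well-ordered) `≤_K`-chain of members of `K`
  is in `K` and is a `≤_K`-upper bound of the chain. -/
  chain_mem : ∀ {ι : Type u} [LinearOrder ι] [WellFoundedLT ι] [Nonempty ι]
    {M : Type u} [L.Structure M] (S : ι → L.Substructure M),
    (∀ i, mem (S i)) → (∀ i j, i < j → toStructureClass.Le (S i) (S j)) →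
    (⋃ i, (S i : Set M)) = Set.univ → mem M ∧ ∀ i, strong (S i)
  /-- Second chain axiom: if all members of such a chain are `K`-substructures of `N`, then so is
  the union `T` of the chain. -/
  chain_strong : ∀ {ι : Type u} [LinearOrder ι] [WellFoundedLT ι] [Nonempty ι]
    {N : Type u} [L.Structure N] (S : ι → L.Substructure N) (T : L.Substructure N),
    (∀ i j, i < j → toStructureClass.Le (S i) (S j)) → (∀ i, strong (S i)) →
    (T : Set N) = (⋃ i, (S i : Set N)) → strong T

namespace AEC

variable {L : Language.{u, u}}

/-- The Löwenheim-Skolem number `LS(K)`. -/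
noncomputable def LS (K : AEC L) : Cardinal.{u} :=
  sInf {κ | K.toStructureClass.IsLSBound κ}

/-- The pairs `M ≤_K N` with `M` and `N` both of cardinality `κ`. -/
structure StrongPair (K : AEC L) (κ : Cardinal.{u}) where
  /-- The universe of the larger structure. -/
  big : Type u
  /-- The larger structure. -/
  [str : L.Structure big]
  /-- The smaller structure. -/
  small : L.Substructure big
  strong : K.strong small
  card_big : #big = κ
  card_small : #small = κ

attribute [instance] StrongPair.str

/-- `(M₁, N₁) ≅ (M₂, N₂)`: some isomorphism of `N₁` with `N₂` carries `M₁` onto `M₂`. -/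
def StrongPair.Iso {K : AEC L} {κ : Cardinal.{u}} (p q : K.StrongPair κ) : Prop :=
  ∃ g : p.big ≃[L] q.big, p.small.map g.toHom = q.small

/-- Isomorphism of pairs is an equivalence relation. -/
def strongPairSetoid (K : AEC L) (κ : Cardinal.{u}) : Setoid (K.StrongPair κ) where
  r := StrongPair.Iso
  iseqv :=
    { refl := fun p => ⟨Equiv.refl L p.big, by ext x; simp⟩
      symm := by
        rintro p q ⟨g, hg⟩
        refine ⟨g.symm, ?_⟩
        rw [← hg]
        ext x
        simp
      trans := by
        rintro p q r ⟨g, hg⟩ ⟨h, hh⟩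
        refine ⟨h.comp g, ?_⟩
        rw [← hh, ← hg]
        ext x
        simp }

/-- `I₂(κ, K)`, the number of isomorphism types of pairs `M ≤_K N` with `M`, `N` in `K_κ`. It is
counted in the universe of the class of all such pairs. -/
noncomputable def I₂ (K : AEC L) (κ : Cardinal.{u}) : Cardinal.{u + 1} :=
  #(Quotient (K.strongPairSetoid κ))

end AEC

/-- A set of `L`-formulas in finitely many free variables. -/
abbrev FormulaSet (L : Language.{u, u}) : Type u :=
  Σ n : ℕ, Set (L.Formula (Fin n))

namespace FormulaSet

variable {L : Language.{u, u}}

/-- The tuple `a` of `M` satisfies all formulas of `p`. -/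
def RealizedBy (p : FormulaSet L) {M : Type u} [L.Structure M] (a : Fin p.1 → M) : Prop :=
  ∀ θ ∈ p.2, Formula.Realize θ a

/-- `M` omits `p`. -/
def OmittedIn (p : FormulaSet L) (M : Type u) [L.Structure M] : Prop :=
  ¬ ∃ a : Fin p.1 → M, p.RealizedBy a

/-- `p` is a type over `T`: it is realized in some model of `T`. -/
def IsTypeOver (p : FormulaSet L) (T : L.Theory) : Prop :=
  ∃ (M : Theory.ModelType.{u, u, u} T) (a : Fin p.1 → M), p.RealizedBy a

end FormulaSet

/-- `M ∈ EC(T, Γ)`: the structure `M` is a model of `T` omitting all members of `Γ`. -/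
def EC {L : Language.{u, u}} (T : L.Theory) (Γ : Set (FormulaSet L))
    (M : Type u) [L.Structure M] : Prop :=
  M ⊨ T ∧ ∀ p ∈ Γ, p.OmittedIn M

/-- `M ∈ PC(T, Γ, L)`: the `L`-structure `M` is the reduct of some `L'`-structure in `EC(T, Γ)`. -/
def PC {L L' : Language.{u, u}} (ι : L →ᴸ L') (T : L'.Theory) (Γ : Set (FormulaSet L'))
    (M : Type u) [L.Structure M] : Prop :=
  ∃ _ : L'.Structure M, ι.IsExpansionOn M ∧ EC T Γ M

end FirstOrder.Language

/-!
The presentation works by coding, inside each member `N` of `K`, a system of small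
`K`-substructures indexed by the finite tuples of `N`. Every tuple `b` gets a hull `M_b`, a
substructure of cardinality `LS(K)` that contains `b`, such that `M_a ≤_K M_b` whenever `a` is a
subtuple of `b`. Such systems exist by the Löwenheim-Skolem axiom and coherence, and can be chosen
so that hulls of tuples of a given `M ≤_K N` stay inside `M` (`AEC.exists_finset_system`).
Conversely, the union of such a system over any set of tuples is a member of `K`, and larger
unions are `≤_K`-above smaller ones (`AEC.finUnion_le_finUnion`).

The expanded language enumerates `M_b` by functions indexed by a set `I` of size `LS(K)`. To say
that `M_a ≤_K M_b`, it suffices to say that the pair `(M_a, M_b)` is isomorphic to one of the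
`I₂(LS(K), K)` many representatives, indexed by `W`. Fixing in advance one enumeration of each
representative, and adding for each subtuple `a` of `b` a second enumeration of `M_b` adapted to
the pair, the isomorphism becomes a set of `LS(K)` many conditions, guarded by a predicate naming
the representative. This is why `LS(K) + I₂(LS(K), K)` symbols and types are enough, whereas
listing the quantifier-free types of tuples would need up to `2 ^ LS(K)`.

All the conditions have the form "for all tuples, a possibly infinite disjunction of
quantifier-free formulas holds" (`AEC.IsPresented`, `AEC.holdsIn_clauses_iff`), that is, a certain
quantifier-free type is omitted; in particular they pass to substructures. The theory `T` is
empty. The set of conditions may be unsatisfiable (for instance if no member of `K` has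
cardinality at least `LS(K)`), while every type has to be realized in some model of `T`; each type
is therefore weakened by a guard predicate, which its omission forces to be true.
-/

namespace FirstOrder.Language

open Set

variable {L : Language.{u, u}}

/-! ### The relation `≤_K` between substructures of one structure -/

namespace Substructure

variable {M : Type u} [L.Structure M]

theorem map_subtype_comap {S T : L.Substructure M} (h : S ≤ T) :
    (S.comap T.subtype.toHom).map T.subtype.toHom = S := by
  ext x
  simp only [mem_map, mem_comap]
  exact ⟨fun ⟨y, hy, hyx⟩ => hyx ▸ hy, fun hx => ⟨⟨x, h hx⟩, hx, rfl⟩⟩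

end Substructure

namespace AEC

open Substructure

variable (K : AEC L) {A N : Type u} [L.Structure A] [L.Structure N]

/-- The `K`-substructure relation between two substructures of one structure. -/
abbrev Le (S T : L.Substructure N) : Prop := K.toStructureClass.Le S T

theorem strong_map_equiv_iff (g : A ≃[L] N) (S : L.Substructure A) :
    K.strong (S.map g.toHom) ↔ K.strong S := by
  refine ⟨fun h => ?_, K.strong_iso g S⟩
  have h' := K.strong_iso g.symm _ h
  convert h'
  ext x
  simp

theorem mem_iff_of_equiv (g : A ≃[L] N) : K.mem A ↔ K.mem N :=
  ⟨K.mem_iso g, K.mem_iso g.symm⟩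

variable {K}

/-- `≤_K` between substructures is absolute: it can be computed in any structure containing
them. -/
theorem le_map_iff (φ : A ↪[L] N) {S T : L.Substructure A} :
    K.Le (S.map φ.toHom) (T.map φ.toHom) ↔ K.Le S T := by
  refine and_congr (map_le_map_iff_of_injective φ.injective) ?_
  rw [← K.strong_map_equiv_iff (φ.substructureEquivMap T)]
  convert Iff.rfl
  ext ⟨y, hy⟩
  obtain ⟨x, hx, rfl⟩ := hy
  simp only [mem_map, mem_comap]
  constructor
  · rintro ⟨z, hz, hzx⟩
    exact ⟨z, hz, congrArg Subtype.val hzx⟩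
  · rintro ⟨z, hz, hzx⟩
    obtain rfl : z = x := φ.injective hzx
    exact ⟨⟨z, hx⟩, hz, rfl⟩

theorem le_top_iff {S : L.Substructure N} : K.Le S ⊤ ↔ K.strong S := by
  refine (and_iff_right le_top).trans ?_
  rw [← K.strong_map_equiv_iff (topEquiv (L := L) (M := N))]
  convert Iff.rfl
  exact (map_subtype_comap le_top).symm

theorem le_range_iff (φ : A ↪[L] N) {S : L.Substructure A} :
    K.Le (S.map φ.toHom) φ.toHom.range ↔ K.strong S := by
  rw [Hom.range_eq_map, le_map_iff, le_top_iff]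

theorem le_comap_iff {S T U : L.Substructure N} (hS : S ≤ U) (hT : T ≤ U) :
    K.Le (S.comap U.subtype.toHom) (T.comap U.subtype.toHom) ↔ K.Le S T := by
  rw [← le_map_iff U.subtype, map_subtype_comap hS, map_subtype_comap hT]

theorem mem_comap_iff {S U : L.Substructure N} (hS : S ≤ U) :
    K.mem (S.comap U.subtype.toHom) ↔ K.mem S := by
  rw [K.mem_iff_of_equiv (U.subtype.substructureEquivMap _), map_subtype_comap hS]

theorem Le.mem_right {S T : L.Substructure N} (h : K.Le S T) : K.mem T :=
  (K.mem_of_strong _ h.2).2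

theorem Le.trans {S T U : L.Substructure N} (h : K.Le S T) (h' : K.Le T U) : K.Le S U :=
  ⟨h.1.trans h'.1, K.strong_trans _ _ ((le_comap_iff (h.1.trans h'.1) h'.1).2 h) h'.2⟩

theorem strong_of_le {S T : L.Substructure N} (h : K.Le S T) (hT : K.strong T) : K.strong S :=
  K.strong_trans S T h hT

/-- The first chain axiom, for a chain inside a fixed ambient structure. -/
theorem le_of_chain {ι : Type u} [LinearOrder ι] [WellFoundedLT ι] [Nonempty ι]
    {S : ι → L.Substructure N} {T : L.Substructure N} (hmem : ∀ i, K.mem (S i))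
    (hS : ∀ i j, i < j → K.Le (S i) (S j)) (hT : (T : Set N) = ⋃ i, (S i : Set N)) (i : ι) :
    K.Le (S i) T := by
  have hle : ∀ i, S i ≤ T := fun i x hx => by
    have : x ∈ (T : Set N) := hT ▸ mem_iUnion.2 ⟨i, hx⟩
    exact this
  refine ⟨hle i, (K.chain_mem (fun i => (S i).comap T.subtype.toHom)
    (fun i => (mem_comap_iff (hle i)).2 (hmem i))
    (fun i j hij => (le_comap_iff (hle i) (hle j)).2 (hS i j hij)) ?_).2 i⟩
  refine eq_univ_of_forall fun x => ?_
  have : (x : N) ∈ (T : Set N) := x.2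
  rw [hT, mem_iUnion] at this
  obtain ⟨i, hi⟩ := this
  exact mem_iUnion.2 ⟨i, hi⟩

/-- The second chain axiom, for a chain inside a fixed ambient structure. -/
theorem le_of_chain_le {ι : Type u} [LinearOrder ι] [WellFoundedLT ι] [Nonempty ι]
    {S : ι → L.Substructure N} {T U : L.Substructure N}
    (hS : ∀ i j, i < j → K.Le (S i) (S j)) (hU : ∀ i, K.Le (S i) U)
    (hT : (T : Set N) = ⋃ i, (S i : Set N)) : K.Le T U := by
  have hle : T ≤ U := fun x hx => by
    have : x ∈ (T : Set N) := hx
    rw [hT, mem_iUnion] at this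
    obtain ⟨i, hi⟩ := this
    exact (hU i).1 hi
  refine ⟨hle, K.chain_strong (fun i => (S i).comap U.subtype.toHom) _
    (fun i j hij => (le_comap_iff (hU i).1 (hU j).1).2 (hS i j hij)) (fun i => (hU i).2) ?_⟩
  ext x
  change (x : N) ∈ (T : Set N) ↔ _
  rw [hT]
  simp only [mem_iUnion]
  rfl

/-! ### Unions of systems indexed by the finite subsets of a structure -/

variable {D : Finset N → L.Substructure N}

open Classical in
/-- The union of the substructures `D s`, for `s` a finite subset of `X`. -/
noncomputable def finUnion (D : Finset N → L.Substructure N) (hD : Monotone D) (X : Set N) :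
    L.Substructure N where
  carrier := ⋃ s : {s : Finset N // (s : Set N) ⊆ X}, (D s : Set N)
  fun_mem {n} f x hx := by
    simp only [mem_iUnion] at hx ⊢
    choose s hs using hx
    refine ⟨⟨Finset.univ.biUnion fun k => (s k : Finset N), ?_⟩,
      (D _).fun_mem f x fun k => ?_⟩
    · simpa using fun k => (s k).2
    · exact hD (Finset.subset_biUnion_of_mem (fun k => (s k : Finset N)) (Finset.mem_univ k)) (hs k)

theorem mem_finUnion {hD : Monotone D} {X : Set N} {x : N} :
    x ∈ finUnion D hD X ↔ ∃ s : Finset N, (s : Set N) ⊆ X ∧ x ∈ D s := by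
  change x ∈ (⋃ s : {s : Finset N // (s : Set N) ⊆ X}, (D s : Set N)) ↔ _
  simp [mem_iUnion]

theorem finUnion_coe {hD : Monotone D} (s : Finset N) : finUnion D hD s = D s := by
  ext x
  rw [mem_finUnion]
  exact ⟨fun ⟨t, ht, hx⟩ => hD (Finset.coe_subset.1 ht) hx, fun hx => ⟨s, Subset.rfl, hx⟩⟩

theorem coe_finUnion_eq_iUnion {hD : Monotone D} {ι : Type u} [LinearOrder ι] [Nonempty ι]
    {Y : ι → Set N} (hY : Monotone Y) :
    (finUnion D hD (⋃ i, Y i) : Set N) = ⋃ i, (finUnion D hD (Y i) : Set N) := by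
  ext x
  simp only [mem_iUnion, SetLike.mem_coe, mem_finUnion]
  constructor
  · rintro ⟨s, hs, hx⟩
    obtain ⟨i, hi⟩ := (hY.directed_le).exists_mem_subset_of_finset_subset_biUnion hs
    exact ⟨i, s, hi, hx⟩
  · rintro ⟨i, s, hs, hx⟩
    exact ⟨s, hs.trans (subset_iUnion Y i), hx⟩

/-- An AEC is closed under unions of directed systems indexed by finite sets. The proof is by
induction on the cardinality of `Y`: an infinite `Y` is the union of the proper initial segments of
an enumeration in the order type of its cardinal, so the chain axioms apply. -/
theorem finUnion_le_finUnion (hm : Monotone D) (hD : ∀ s t, s ⊆ t → K.Le (D s) (D t))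
    {X Y : Set N} (hXY : X ⊆ Y) : K.Le (finUnion D hm X) (finUnion D hm Y) := by
  obtain ⟨κ, hκ⟩ : ∃ κ, #Y = κ := ⟨_, rfl⟩
  induction κ using WellFoundedLT.induction generalizing X Y with
  | ind κ ih =>
  rcases lt_or_ge κ ℵ₀ with hfin | hinf
  · have hY : Y.Finite := lt_aleph0_iff_set_finite.1 (hκ ▸ hfin)
    obtain ⟨t, rfl⟩ := hY.exists_finset_coe
    obtain ⟨s, rfl⟩ := (hY.subset hXY).exists_finset_coe
    rw [finUnion_coe, finUnion_coe]
    exact hD s t (Finset.coe_subset.1 hXY)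
  have : NoMaxOrder κ.ord.ToType := noMaxOrder hinf
  have : Nonempty κ.ord.ToType := by
    rw [← mk_ne_zero_iff, mk_ord_toType]
    exact (aleph0_pos.trans_le hinf).ne'
  obtain ⟨e⟩ : Nonempty (κ.ord.ToType ≃ Y) := by
    rw [← Cardinal.eq, mk_ord_toType, hκ]
  let Z : κ.ord.ToType → Set N := fun i => (fun j => (e j : N)) '' Iio i
  have hZ : Monotone Z := fun i j h => image_mono (Iio_subset_Iio h)
  have hZlt : ∀ i, #(Z i) < κ := fun i => mk_image_le.trans_lt (by
    simpa using mk_Iio_lt i (by simp))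
  have hZY : ⋃ i, Z i = Y := by
    ext y
    simp only [mem_iUnion]
    constructor
    · rintro ⟨i, j, -, rfl⟩
      exact (e j).2
    · intro hy
      obtain ⟨i, hi⟩ := exists_gt (e.symm ⟨y, hy⟩)
      exact ⟨i, _, hi, by simp⟩
  have hXZ : ⋃ i, X ∩ Z i = X := by rw [← inter_iUnion, hZY, inter_eq_left.2 hXY]
  have hXZlt : ∀ i, #(X ∩ Z i : Set N) < κ := fun i =>
    (mk_le_mk_of_subset inter_subset_right).trans_lt (hZlt i)
  -- The union for `Y` is `≤_K`-above its pieces by the first chain axiom, hence above the pieces of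
  -- the union for `X`, so that the second chain axiom applies to the latter.
  have hY : ∀ i, K.Le (finUnion D hm (Z i)) (finUnion D hm Y) := by
    refine le_of_chain (fun i => (ih _ (hZlt i) (Subset.refl (Z i)) rfl).mem_right)
      (fun i j hij => ih _ (hZlt j) (hZ hij.le) rfl) ?_
    rw [← coe_finUnion_eq_iUnion hZ, hZY]
  refine le_of_chain_le (S := fun i => finUnion D hm (X ∩ Z i))
    (fun i j hij => ih _ (hXZlt j) (inter_subset_inter_right X (hZ hij.le)) rfl)
    (fun i => (ih _ (hZlt i) inter_subset_right rfl).trans (hY i)) ?_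
  rw [← coe_finUnion_eq_iUnion fun i j h => inter_subset_inter_right X (hZ h), hXZ]

end AEC

/-! ### Types embedding in a given infinite type -/

section EmbedsIn

universe v w

/-- `A` embeds in `X`: a form of `#A ≤ #X` that needs no universe lifts. -/
def EmbedsIn (X : Type u) (A : Type v) : Prop := Nonempty (A ↪ X)

variable {X : Type u} {A : Type v}

namespace EmbedsIn

theorem of_injective {B : Type w} (hB : EmbedsIn X B) (f : A → B) (hf : Function.Injective f) :
    EmbedsIn X A :=
  hB.map fun g => (⟨f, hf⟩ : A ↪ B).trans g

theorem range {B : Type w} (hA : EmbedsIn X A) (f : A → B) : EmbedsIn X (Set.range f) :=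
  hA.of_injective (rangeSplitting f) (rangeSplitting_injective f)

theorem of_mk_le {A : Type u} (h : #A ≤ #X) : EmbedsIn X A := h

variable [Infinite X]

theorem of_countable [Countable A] : EmbedsIn X A := by
  obtain ⟨f, hf⟩ := exists_injective_nat A
  exact ⟨(⟨f, hf⟩ : A ↪ ℕ).trans (Infinite.natEmbedding X)⟩

theorem prod {B : Type w} (hA : EmbedsIn X A) (hB : EmbedsIn X B) : EmbedsIn X (A × B) := by
  obtain ⟨f⟩ := hA
  obtain ⟨g⟩ := hB
  obtain ⟨e⟩ : Nonempty (X × X ≃ X) := by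
    rw [← Cardinal.eq, mk_prod, lift_id, mul_eq_self (aleph0_le_mk X)]
  exact ⟨(f.prodMap g).trans e.toEmbedding⟩

theorem sigma {B : A → Type w} (hA : EmbedsIn X A) (hB : ∀ a, EmbedsIn X (B a)) :
    EmbedsIn X (Σ a, B a) := by
  have f := fun a => (hB a).some
  have hX : EmbedsIn X X := ⟨Function.Embedding.refl X⟩
  refine (hA.prod hX).of_injective (fun p => (p.1, f p.1 p.2)) ?_
  rintro ⟨a, b⟩ ⟨a', b'⟩ h
  obtain ⟨h₁, h₂⟩ := Prod.mk.inj h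
  change a = a' at h₁
  subst h₁
  exact congrArg _ ((f a).injective h₂)

theorem sum {B : Type w} (hA : EmbedsIn X A) (hB : EmbedsIn X B) : EmbedsIn X (A ⊕ B) := by
  have hX : EmbedsIn X X := ⟨Function.Embedding.refl X⟩
  obtain ⟨f⟩ := hA
  obtain ⟨g⟩ := hB
  refine ((of_countable (X := X) (A := Bool)).prod hX).of_injective
    (Sum.elim (fun a => (true, f a)) fun b => (false, g b)) ?_
  rintro (a | a) (b | b) h <;> simp_all

theorem finArrow (hA : EmbedsIn X A) (n : ℕ) : EmbedsIn X (Fin n → A) := by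
  induction n with
  | zero => exact of_countable
  | succ n ih =>
    exact (hA.prod ih).of_injective _ (Fin.consEquiv fun _ : Fin (n + 1) => A).symm.injective

theorem union {s t : Set A} (hs : EmbedsIn X s) (ht : EmbedsIn X t) :
    EmbedsIn X (s ∪ t : Set A) := by
  classical
  refine (hs.sum ht).of_injective
    (fun x => if h : (x : A) ∈ s then Sum.inl ⟨x, h⟩ else Sum.inr ⟨x, x.2.resolve_left h⟩) ?_
  intro x y h
  dsimp only at h
  split_ifs at h with hx hy hy
  · exact Subtype.ext (by simpa using h)
  · exact Subtype.ext (by simpa using h)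

end EmbedsIn

end EmbedsIn

namespace AEC

open Substructure

variable {K : AEC L} {N : Type u} [L.Structure N]

theorem isLSBound_LS (K : AEC L) : K.toStructureClass.IsLSBound K.LS :=
  csInf_mem (s := {κ | K.toStructureClass.IsLSBound κ}) K.exists_isLSBound

/-! ### Representatives of the isomorphism types of pairs -/

/-- A pair is determined up to isomorphism by its transport to a fixed set of size `κ`. -/
theorem small_quotient_strongPairSetoid (K : AEC L) (κ : Cardinal.{u}) :
    Small.{u} (Quotient (K.strongPairSetoid κ)) := by
  obtain ⟨X, hX⟩ : ∃ X : Type u, #X = κ := ⟨κ.out, mk_out κ⟩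
  have e : ∀ p : K.StrongPair κ, p.big ≃ X := fun p =>
    (Cardinal.eq.1 (p.card_big.trans hX.symm)).some
  let code : K.StrongPair κ → L.Structure X × Set X := fun p =>
    ((e p).inducedStructure, e p '' (p.small : Set p.big))
  have hcode : ∀ p q, code p = code q → p.Iso q := by
    intro p q h
    have h1 : (e p).inducedStructure (L := L) = (e q).inducedStructure := congrArg Prod.fst h
    have h2 : e p '' (p.small : Set p.big) = e q '' (q.small : Set q.big) := congrArg Prod.snd h
    have hfun : ∀ {n} (f : L.Functions n) (x : Fin n → X),
        e p (Structure.funMap f ((e p).symm ∘ x)) = e q (Structure.funMap f ((e q).symm ∘ x)) :=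
      fun f x => congrArg (fun S : L.Structure X => S.funMap f x) h1
    have hrel : ∀ {n} (r : L.Relations n) (x : Fin n → X),
        Structure.RelMap r ((e p).symm ∘ x) = Structure.RelMap r ((e q).symm ∘ x) :=
      fun r x => congrArg (fun S : L.Structure X => S.RelMap r x) h1
    refine ⟨{ toEquiv := (e p).trans (e q).symm, map_fun' := ?_, map_rel' := ?_ }, ?_⟩
    · intro n f x
      have := hfun f (e p ∘ x)
      rw [← Function.comp_assoc, _root_.Equiv.symm_comp_self, Function.id_comp] at this
      exact (e q).symm_apply_eq.2 this
    · intro n r x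
      have := hrel r (e p ∘ x)
      rw [← Function.comp_assoc, _root_.Equiv.symm_comp_self, Function.id_comp] at this
      exact Iff.of_eq this.symm
    · apply SetLike.coe_injective
      change (fun x => (e q).symm (e p x)) '' (p.small : Set p.big) = q.small
      rw [← image_image, h2, (e q).symm_image_image]
  refine small_of_injective (f := fun q : Quotient (K.strongPairSetoid κ) => code q.out) ?_
  intro q r h
  rw [← q.out_eq, ← r.out_eq]
  exact Quotient.sound (hcode _ _ h)

/-- The isomorphism types of pairs can be represented by a family indexed in the universe of the
structures. -/
theorem exists_representatives (K : AEC L) (κ : Cardinal.{u}) :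
    ∃ (W : Type u) (rep : W → K.StrongPair κ),
      Cardinal.lift.{u + 1} #W = K.I₂ κ ∧ ∀ p, ∃ w, (rep w).Iso p := by
  have := K.small_quotient_strongPairSetoid κ
  refine ⟨Shrink.{u} (Quotient (K.strongPairSetoid κ)),
    fun w => ((equivShrink _).symm w).out, ?_, fun p => ⟨equivShrink _ ⟦p⟧, ?_⟩⟩
  · have := Cardinal.lift_mk_eq'.2 ⟨(equivShrink.{u} (Quotient (K.strongPairSetoid κ))).symm⟩
    rw [I₂]
    rwa [Cardinal.lift_id'.{u, u + 1}] at this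
  · refine Quotient.exact (s := K.strongPairSetoid κ) ((Quotient.out_eq _).trans ?_)
    exact _root_.Equiv.symm_apply_apply _ _

/-! ### Systems of small substructures -/

/-- The Löwenheim-Skolem axiom, with `S` inside a given `K`-substructure `M` whenever `A` is. -/
theorem exists_strong_superset {M : L.Substructure N} (hM : K.strong M) (A : Set N) :
    ∃ S : L.Substructure N, A ⊆ S ∧ K.strong S ∧ #S ≤ K.LS + #A ∧ (A ⊆ M → S ≤ M) := by
  by_cases hA : A ⊆ M
  · obtain ⟨S, hAS, hS, hcard⟩ := K.isLSBound_LS.2.2 M (K.mem_of_strong _ hM).1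
      (M.subtype ⁻¹' A)
    have hle : K.Le (S.map M.subtype.toHom) M := by
      have := (le_map_iff M.subtype).2 (le_top_iff.2 hS)
      rwa [← Hom.range_eq_map, range_subtype] at this
    refine ⟨S.map M.subtype.toHom, fun a ha => ⟨⟨a, hA ha⟩, hAS ha, rfl⟩, strong_of_le hle hM,
      ?_, fun _ => hle.1⟩
    rw [← mk_congr (M.subtype.substructureEquivMap S).toEquiv]
    refine hcard.trans (add_le_add_right (mk_preimage_of_injective _ _ M.subtype.injective) _)
  · obtain ⟨S, hAS, hS, hcard⟩ := K.isLSBound_LS.2.2 N (K.mem_of_strong _ hM).2 A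
    exact ⟨S, hAS, hS, hcard, fun h => absurd h hA⟩

/-- A monotone system of `K`-substructures of size `LS(K)`, indexed by the finite subsets of `N`,
that respects a given `K`-substructure `M`. It is built by recursion on finite sets, from the
closures given by `exists_strong_superset`. -/
theorem exists_finset_system {M : L.Substructure N} (hM : K.strong M) (hcard : K.LS ≤ #M) :
    ∃ D : Finset N → L.Substructure N, Monotone D ∧ (∀ s : Finset N, (s : Set N) ⊆ D s) ∧
      (∀ s, K.strong (D s)) ∧ (∀ s, #(D s) = K.LS) ∧ ∀ s : Finset N, (s : Set N) ⊆ M → D s ≤ M := by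
  classical
  choose cl hcl hstrong hle hclM using exists_strong_superset hM
  obtain ⟨A, hA⟩ := le_mk_iff_exists_set.1 hcard
  -- Including a fixed `B ⊆ M` of size `LS(K)` in every member makes the cardinalities exact.
  let B : Set N := Subtype.val '' A
  have hB : #B = K.LS := by rw [mk_image_eq Subtype.val_injective, hA]
  have hBM : B ⊆ M := by
    rintro _ ⟨x, -, rfl⟩
    exact x.2
  let hull : (s : Finset N) → ((t : Finset N) → t ⊂ s → L.Substructure N) → Set N := fun s f =>
    B ∪ s ∪ ⋃ t : {t : Finset N // t ⊂ s}, (f t.1 t.2 : Set N)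
  let D : Finset N → L.Substructure N := Finset.strongInduction fun s f => cl (hull s f)
  have hD : ∀ s, D s = cl (hull s fun t _ => D t) := fun s => Finset.strongInduction_eq _ s
  have hsub : ∀ s, hull s (fun t _ => D t) ⊆ D s := fun s => by
    conv_rhs => rw [hD]
    exact hcl _
  have hLS : ℵ₀ ≤ K.LS := K.isLSBound_LS.1
  refine ⟨D, fun s t hst => ?_, fun s => ?_, fun s => ?_, fun s => le_antisymm ?_ ?_, fun s => ?_⟩
  · rcases hst.eq_or_ssubset with rfl | h
    · exact le_rfl
    · exact fun x hx => hsub t (Or.inr (mem_iUnion.2 ⟨⟨s, h⟩, hx⟩))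
  · exact fun x hx => hsub s (Or.inl (Or.inr hx))
  · rw [hD]
    exact hstrong _
  · induction s using Finset.strongInduction with
    | H s ih =>
    rw [hD]
    refine (hle _).trans (add_le_of_le hLS le_rfl ?_)
    refine (mk_union_le _ _).trans (add_le_of_le hLS ((mk_union_le _ _).trans
      (add_le_of_le hLS hB.le ?_)) ?_)
    · exact (mk_lt_aleph0 (α := (s : Set N))).le.trans hLS
    · refine (mk_iUnion_le _).trans (mul_le_of_le hLS ?_ (ciSup_le' fun t => ih t.1 t.2))
      have : Finite {t : Finset N // t ⊂ s} := (finite_Iio s).to_subtype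
      exact (mk_lt_aleph0 (α := {t : Finset N // t ⊂ s})).le.trans hLS
  · exact hB.symm.le.trans (mk_le_mk_of_subset fun x hx => hsub s (Or.inl (Or.inl hx)))
  · induction s using Finset.strongInduction with
    | H s ih =>
    intro hs
    rw [hD]
    refine hclM _ (union_subset (union_subset hBM hs) (iUnion_subset fun t => ?_))
    exact ih t.1 t.2 ((Finset.coe_subset.2 t.2.subset).trans hs)

end AEC

/-! ### The expanded language -/

/-- An `n`-tuple of entries of an `m`-tuple `b`, as a reindexing `σ`; the tuple itself is
`b ∘ σ`. -/
abbrev Subtuple (m : ℕ) : Type := Σ n : ℕ, Fin n → Fin m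

/-- The symbols added to `L`: in each arity `m`, functions enumerating along `I` the hull `M_b` of
an `m`-tuple `b`; for each subtuple `a` of `b`, functions enumerating `M_b` along `I` in a way
adapted to `(M_a, M_b)`, and predicates naming the isomorphism type `w : W` of that pair; and a
predicate meant to be always true. -/
def witnessLang (I W : Type u) : Language.{u, u} where
  Functions m := I ⊕ Subtuple m × I
  Relations m := (Subtuple m × W) ⊕ PUnit

/-- The language `L` with the symbols of `witnessLang I W` added. -/
abbrev presLang (L : Language.{u, u}) (I W : Type u) : Language.{u, u} := L.sum (witnessLang I W)

section Symbols

variable (L : Language.{u, u}) {I W : Type u} {m : ℕ}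

/-- The symbol for the `i`-th element of the hull of an `m`-tuple. -/
def hullSym (W : Type u) (i : I) (m : ℕ) : (presLang L I W).Functions m := Sum.inr (Sum.inl i)

/-- The symbol for the `i`-th element of the hull, enumerated according to the subtuple `s`. -/
def pairSym (W : Type u) (s : Subtuple m) (i : I) : (presLang L I W).Functions m :=
  Sum.inr (Sum.inr (s, i))

/-- The predicate saying that the hulls of the subtuple `s` and of the tuple have type `w`. -/
def typeSym (I : Type u) (s : Subtuple m) (w : W) : (presLang L I W).Relations m :=
  Sum.inr (Sum.inl (s, w))

/-- The predicate meant to be always true. -/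
def guardSym (I W : Type u) (m : ℕ) : (presLang L I W).Relations m := Sum.inr (Sum.inr PUnit.unit)

/-- The term for the `i`-th element of the hull of the subtuple `σ`. -/
def hullTerm (W : Type u) {n : ℕ} (i : I) (σ : Fin n → Fin m) : (presLang L I W).Term (Fin m) :=
  Term.func (hullSym L W i n) fun k => .var (σ k)

/-- The term for the `i`-th element of the hull, enumerated according to the subtuple `s`. -/
def pairTerm (W : Type u) (s : Subtuple m) (i : I) : (presLang L I W).Term (Fin m) :=
  (pairSym L W s i).term

/-- The formula saying that the hulls of the subtuple `s` and of the tuple have type `w`. -/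
def typeFormula (I : Type u) (s : Subtuple m) (w : W) : (presLang L I W).Formula (Fin m) :=
  (typeSym L I s w).formula .var

/-- The guard, as a formula. -/
def guardFormula (I W : Type u) (m : ℕ) : (presLang L I W).Formula (Fin m) :=
  (guardSym L I W m).formula .var

end Symbols

section Realize

variable {L : Language.{u, u}} {I W : Type u} {m : ℕ} {N : Type u} [(presLang L I W).Structure N]

open Structure

@[simp]
theorem realize_hullTerm {n : ℕ} (i : I) (σ : Fin n → Fin m) (b : Fin m → N) :
    (hullTerm L W i σ).realize b = funMap (hullSym L W i n) (b ∘ σ) := rfl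

@[simp]
theorem realize_pairTerm (s : Subtuple m) (i : I) (b : Fin m → N) :
    (pairTerm L W s i).realize b = funMap (pairSym L W s i) b := rfl

@[simp]
theorem realize_typeFormula (s : Subtuple m) (w : W) (b : Fin m → N) :
    (typeFormula L I s w).Realize b ↔ RelMap (typeSym L I s w) b :=
  Formula.realize_rel

@[simp]
theorem realize_guardFormula (b : Fin m → N) :
    (guardFormula L I W m).Realize b ↔ RelMap (guardSym L I W m) b :=
  Formula.realize_rel

end Realize

/-! ### Disjunctive clauses and the types they forbid -/

section Clauses

variable {L : Language.{u, u}}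

/-- The universal closure of the infinitary disjunction of the formulas in `C` holds in `N`. -/
def HoldsIn {m : ℕ} (C : Set (L.Formula (Fin m))) (N : Type u) [L.Structure N] : Prop :=
  ∀ b : Fin m → N, ∃ θ ∈ C, θ.Realize b

/-- The clause saying that `φ` implies the disjunction of `C`. -/
def implies {m : ℕ} (φ : L.Formula (Fin m)) (C : Set (L.Formula (Fin m))) :
    Set (L.Formula (Fin m)) :=
  insert φ.not C

variable {N : Type u} [L.Structure N] {m : ℕ}

theorem holdsIn_implies {φ : L.Formula (Fin m)} {C : Set (L.Formula (Fin m))} :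
    HoldsIn (implies φ C) N ↔ ∀ b : Fin m → N, φ.Realize b → ∃ θ ∈ C, θ.Realize b := by
  refine forall_congr' fun b => ?_
  simp only [implies, exists_mem_insert, Formula.realize_not, imp_iff_not_or]

theorem holdsIn_range {J : Type*} {f : J → L.Formula (Fin m)} :
    HoldsIn (range f) N ↔ ∀ b : Fin m → N, ∃ j, (f j).Realize b :=
  forall_congr' fun _ => exists_range_iff

theorem isQF_equal {t₁ t₂ : L.Term (Fin m)} : (t₁.equal t₂).IsQF :=
  (BoundedFormula.IsAtomic.equal _ _).isQF

theorem isQF_rel {n : ℕ} {R : L.Relations n} {ts : Fin n → L.Term (Fin m)} :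
    (R.formula ts).IsQF :=
  (BoundedFormula.IsAtomic.rel _ _).isQF

end Clauses

namespace AEC

open Structure

variable {L : Language.{u, u}} {K : AEC L} {κ : Cardinal.{u}} {I W : Type u}

/-! ### The conditions on the expansions -/

/-- The meaning of the symbols of `presLang L I W` in the expansions used to present `K`. The pairs
`rep w` have their universes enumerated by `I` through `enum w`. -/
structure IsPresented (rep : W → K.StrongPair κ) (enum : ∀ w, (rep w).big ≃ I)
    (N : Type u) [(presLang L I W).Structure N] : Prop where
  mem_hull : ∀ {m} (k : Fin m) (b : Fin m → N), ∃ i : I, b k = funMap (hullSym L W i m) b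
  exists_type : ∀ {m} (s : Subtuple m) (b : Fin m → N), ∃ w : W, RelMap (typeSym L I s w) b
  pair_ne : ∀ {m} (s : Subtuple m) (w : W) (x y : (rep w).big), x ≠ y → ∀ b : Fin m → N,
    RelMap (typeSym L I s w) b →
      funMap (pairSym L W s (enum w x)) b ≠ funMap (pairSym L W s (enum w y)) b
  pair_fun : ∀ {m} (s : Subtuple m) (w : W) {n} (f : L.Functions n) (t : Fin n → (rep w).big)
    (b : Fin m → N), RelMap (typeSym L I s w) b →
      funMap ((LHom.sumInl : L →ᴸ presLang L I W).onFunction f)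
        (fun k => funMap (pairSym L W s (enum w (t k))) b) =
          funMap (pairSym L W s (enum w (funMap f t))) b
  pair_rel : ∀ {m} (s : Subtuple m) (w : W) {n} (r : L.Relations n) (t : Fin n → (rep w).big)
    (b : Fin m → N), RelMap (typeSym L I s w) b →
      (RelMap ((LHom.sumInl : L →ᴸ presLang L I W).onRelation r)
        (fun k => funMap (pairSym L W s (enum w (t k))) b) ↔ RelMap r t)
  pair_mem_hull : ∀ {m} (s : Subtuple m) (i : I) (b : Fin m → N),
    ∃ j : I, funMap (pairSym L W s i) b = funMap (hullSym L W j m) b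
  hull_mem_pair : ∀ {m} (s : Subtuple m) (j : I) (b : Fin m → N),
    ∃ i : I, funMap (hullSym L W j m) b = funMap (pairSym L W s i) b
  small_mem_hull : ∀ {m} (s : Subtuple m) (w : W) (x : (rep w).small) (b : Fin m → N),
    RelMap (typeSym L I s w) b →
      ∃ j : I, funMap (pairSym L W s (enum w x)) b = funMap (hullSym L W j s.1) (b ∘ s.2)
  hull_mem_small : ∀ {m} (s : Subtuple m) (w : W) (j : I) (b : Fin m → N),
    RelMap (typeSym L I s w) b →
      ∃ x : (rep w).small,
        funMap (hullSym L W j s.1) (b ∘ s.2) = funMap (pairSym L W s (enum w x)) b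

section ClauseFamilies

variable (rep : W → K.StrongPair κ) (enum : ∀ w, (rep w).big ≃ I) (m : ℕ)

/-- A family of tautologies, indexed by `I ⊕ W`: as one-element clauses, they make the number of
clauses exactly `#I + #W`. -/
def tautology (x : I ⊕ W) : (presLang L I W).Formula (Fin m) :=
  x.elim (fun i => (hullTerm L W i id).equal (hullTerm L W i id))
    fun w => (typeFormula L I ⟨0, Fin.elim0⟩ w).imp (typeFormula L I ⟨0, Fin.elim0⟩ w)

/-- The `k`-th entry of a tuple lies in its hull. -/
def memHullClause (k : Fin m) : Set ((presLang L I W).Formula (Fin m)) :=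
  range fun i => (Term.var k).equal (hullTerm L W i id)

/-- Some type is assigned to the subtuple `s`. -/
def existsTypeClause (s : Subtuple m) : Set ((presLang L I W).Formula (Fin m)) :=
  range fun w => typeFormula L I s w

/-- The adapted enumeration separates two given points of the representative. -/
def pairNeClause (q : Σ _ : Subtuple m, Σ w, {p : (rep w).big × (rep w).big // p.1 ≠ p.2}) :
    Set ((presLang L I W).Formula (Fin m)) :=
  implies (typeFormula L I q.1 q.2.1)
    {((pairTerm L W q.1 (enum q.2.1 q.2.2.1.1)).equal
      (pairTerm L W q.1 (enum q.2.1 q.2.2.1.2))).not}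

/-- The adapted enumeration respects a given value of a function symbol of `L`. -/
def pairFunClause
    (q : Σ _ : Subtuple m, Σ w, Σ n, L.Functions n × (Fin n → (rep w).big)) :
    Set ((presLang L I W).Formula (Fin m)) :=
  implies (typeFormula L I q.1 q.2.1)
    {(Term.func ((LHom.sumInl : L →ᴸ presLang L I W).onFunction q.2.2.2.1)
      fun k => pairTerm L W q.1 (enum q.2.1 (q.2.2.2.2 k))).equal
      (pairTerm L W q.1 (enum q.2.1 (funMap q.2.2.2.1 q.2.2.2.2)))}

open Classical in
/-- The adapted enumeration respects a given instance of a relation symbol of `L`. -/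
noncomputable def pairRelClause
    (q : Σ _ : Subtuple m, Σ w, Σ n, L.Relations n × (Fin n → (rep w).big)) :
    Set ((presLang L I W).Formula (Fin m)) :=
  let θ := ((LHom.sumInl : L →ᴸ presLang L I W).onRelation q.2.2.2.1).formula
    fun k => pairTerm L W q.1 (enum q.2.1 (q.2.2.2.2 k))
  implies (typeFormula L I q.1 q.2.1) {if RelMap q.2.2.2.1 q.2.2.2.2 then θ else θ.not}

/-- The adapted enumeration takes its values in the hull. -/
def pairMemHullClause (q : Subtuple m × I) : Set ((presLang L I W).Formula (Fin m)) :=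
  range fun j => (pairTerm L W q.1 q.2).equal (hullTerm L W j id)

/-- The adapted enumeration covers the hull. -/
def hullMemPairClause (q : Subtuple m × I) : Set ((presLang L I W).Formula (Fin m)) :=
  range fun i => (hullTerm L W q.2 id).equal (pairTerm L W q.1 i)

/-- The adapted enumeration maps the smaller structure into the hull of the subtuple. -/
def smallMemHullClause (q : Σ _ : Subtuple m, Σ w, (rep w).small) :
    Set ((presLang L I W).Formula (Fin m)) :=
  implies (typeFormula L I q.1 q.2.1)
    (range fun j => (pairTerm L W q.1 (enum q.2.1 q.2.2)).equal (hullTerm L W j q.1.2))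

/-- The adapted enumeration maps the smaller structure onto the hull of the subtuple. -/
def hullMemSmallClause (q : Subtuple m × W × I) : Set ((presLang L I W).Formula (Fin m)) :=
  implies (typeFormula L I q.1 q.2.1)
    (range fun x : (rep q.2.1).small =>
      (hullTerm L W q.2.2 q.1.2).equal (pairTerm L W q.1 (enum q.2.1 x)))

/-- The clauses in `m` variables expressing `IsPresented`. -/
def clauses : Set (Set ((presLang L I W).Formula (Fin m))) :=
  range (fun x => {tautology m x}) ∪ range (memHullClause m) ∪ range (existsTypeClause m) ∪
    range (pairNeClause rep enum m) ∪ range (pairFunClause rep enum m) ∪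
    range (pairRelClause rep enum m) ∪ range (pairMemHullClause m) ∪
    range (hullMemPairClause m) ∪ range (smallMemHullClause rep enum m) ∪
    range (hullMemSmallClause rep enum m)

end ClauseFamilies

variable {rep : W → K.StrongPair κ} {enum : ∀ w, (rep w).big ≃ I}

theorem tautology_injective (m : ℕ) :
    Function.Injective (tautology (L := L) (I := I) (W := W) m) := by
  rintro (i | w) (j | v) h
  · injection h with _ _ h
    injection h with _ h
    injection h with h
    injection h with h
    rw [h]
  · cases h
  · cases h
  · injection h with _ h
    injection h with _ _ h
    injection h with h
    injection h with h
    rw [(Prod.mk.inj h).2]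

theorem tautology_mem_clauses (m : ℕ) (x : I ⊕ W) :
    {tautology (L := L) m x} ∈ clauses rep enum m :=
  .inl <| .inl <| .inl <| .inl <| .inl <| .inl <| .inl <| .inl <| .inl ⟨x, rfl⟩

theorem isQF_of_mem_clauses {m : ℕ} {C : Set ((presLang L I W).Formula (Fin m))}
    (hC : C ∈ clauses rep enum m) {θ : (presLang L I W).Formula (Fin m)} (hθ : θ ∈ C) :
    θ.IsQF := by
  rcases hC with ((((((((⟨i | w, rfl⟩ | ⟨q, rfl⟩) | ⟨q, rfl⟩) | ⟨q, rfl⟩) | ⟨q, rfl⟩) | ⟨q, rfl⟩) |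
    ⟨q, rfl⟩) | ⟨q, rfl⟩) | ⟨q, rfl⟩) | ⟨q, rfl⟩
  · rcases hθ with rfl
    exact isQF_equal
  · rcases hθ with rfl
    exact isQF_rel.imp isQF_rel
  · rcases hθ with ⟨i, rfl⟩
    exact isQF_equal
  · rcases hθ with ⟨w, rfl⟩
    exact isQF_rel
  · rcases hθ with rfl | rfl
    exacts [isQF_rel.not, isQF_equal.not]
  · rcases hθ with rfl | rfl
    exacts [isQF_rel.not, isQF_equal]
  · rcases hθ with rfl | rfl
    · exact isQF_rel.not
    · split_ifs
      exacts [isQF_rel, isQF_rel.not]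
  · rcases hθ with ⟨i, rfl⟩
    exact isQF_equal
  · rcases hθ with ⟨i, rfl⟩
    exact isQF_equal
  · rcases hθ with rfl | ⟨i, rfl⟩
    exacts [isQF_rel.not, isQF_equal]
  · rcases hθ with rfl | ⟨i, rfl⟩
    exacts [isQF_rel.not, isQF_equal]

theorem holdsIn_clauses_iff {N : Type u} [(presLang L I W).Structure N] :
    (∀ m, ∀ C ∈ clauses rep enum m, HoldsIn C N) ↔ IsPresented rep enum N := by
  constructor
  · intro h
    simp only [clauses, mem_union, or_imp, forall_and, forall_mem_range] at h
    obtain ⟨⟨⟨⟨⟨⟨⟨⟨⟨-, h₁⟩, h₂⟩, h₃⟩, h₄⟩, h₅⟩, h₆⟩, h₇⟩, h₈⟩, h₉⟩ := h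
    constructor
    · intro m k b
      simpa using holdsIn_range.1 (h₁ m k) b
    · intro m s b
      simpa using holdsIn_range.1 (h₂ m s) b
    · intro m s w x y hxy b hb
      simpa using holdsIn_implies.1 (h₃ m ⟨s, w, ⟨(x, y), hxy⟩⟩) b ((realize_typeFormula ..).2 hb)
    · intro m s w n f t b hb
      simpa [-LHom.sumInl_onFunction] using
        holdsIn_implies.1 (h₄ m ⟨s, w, n, f, t⟩) b ((realize_typeFormula ..).2 hb)
    · intro m s w n r t b hb
      have := holdsIn_implies.1 (h₅ m ⟨s, w, n, r, t⟩) b ((realize_typeFormula ..).2 hb)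
      by_cases hr : RelMap r t
      · simpa [-LHom.sumInl_onRelation, hr] using this
      · simpa [-LHom.sumInl_onRelation, hr] using this
    · intro m s i b
      simpa using holdsIn_range.1 (h₆ m (s, i)) b
    · intro m s i b
      simpa using holdsIn_range.1 (h₇ m (s, i)) b
    · intro m s w x b hb
      simpa using holdsIn_implies.1 (h₈ m ⟨s, w, x⟩) b ((realize_typeFormula ..).2 hb)
    · intro m s w j b hb
      simpa using holdsIn_implies.1 (h₉ m (s, w, j)) b ((realize_typeFormula ..).2 hb)
  · intro h m C hC
    rcases hC with ((((((((⟨i | w, rfl⟩ | ⟨k, rfl⟩) | ⟨s, rfl⟩) | ⟨⟨s, w, p⟩, rfl⟩) |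
      ⟨⟨s, w, n, f, t⟩, rfl⟩) | ⟨⟨s, w, n, r, t⟩, rfl⟩) |
      ⟨⟨s, i⟩, rfl⟩) | ⟨⟨s, i⟩, rfl⟩) | ⟨⟨s, w, x⟩, rfl⟩) | ⟨⟨s, w, j⟩, rfl⟩
    · exact fun b => ⟨_, rfl, by simp [tautology]⟩
    · exact fun b => ⟨_, rfl, by simp [tautology]⟩
    · exact holdsIn_range.2 fun b => by simpa using h.mem_hull k b
    · exact holdsIn_range.2 fun b => by simpa using h.exists_type s b
    · exact holdsIn_implies.2 fun b hb => by
        simpa using h.pair_ne s w _ _ p.2 b ((realize_typeFormula ..).1 hb)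
    · exact holdsIn_implies.2 fun b hb => by
        simpa [-LHom.sumInl_onFunction] using h.pair_fun s w f t b ((realize_typeFormula ..).1 hb)
    · refine holdsIn_implies.2 fun b hb => ?_
      have := h.pair_rel s w r t b ((realize_typeFormula ..).1 hb)
      by_cases hr : RelMap r t
      · simpa [-LHom.sumInl_onRelation, hr] using this
      · simpa [-LHom.sumInl_onRelation, hr] using this
    · exact holdsIn_range.2 fun b => by simpa using h.pair_mem_hull s i b
    · exact holdsIn_range.2 fun b => by simpa using h.hull_mem_pair s i b
    · exact holdsIn_implies.2 fun b hb => by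
        simpa using h.small_mem_hull s w x b ((realize_typeFormula ..).1 hb)
    · exact holdsIn_implies.2 fun b hb => by
        simpa using h.hull_mem_small s w j b ((realize_typeFormula ..).1 hb)

end AEC

namespace AEC

open Structure Set Substructure

variable {L : Language.{u, u}} {K : AEC L} {κ : Cardinal.{u}} {I W : Type u}

/-! ### The omitted types -/

/-- The type whose omission says that the guard is true and the clause `C` holds. It is realized
wherever the guard is false. -/
def forbidden {m : ℕ} (C : Set ((presLang L I W).Formula (Fin m))) :
    FormulaSet (presLang L I W) :=
  ⟨m, (fun θ => (guardFormula L I W m).imp θ.not) '' C⟩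

/-- The types to be omitted in the presentation of `K`. -/
def forbiddenTypes (rep : W → K.StrongPair κ) (enum : ∀ w, (rep w).big ≃ I) :
    Set (FormulaSet (presLang L I W)) :=
  range fun q : Σ m, clauses rep enum m => forbidden q.2.1

section

variable {rep : W → K.StrongPair κ} {enum : ∀ w, (rep w).big ≃ I}

theorem omittedIn_forbidden_iff {m : ℕ} {C : Set ((presLang L I W).Formula (Fin m))}
    {N : Type u} [(presLang L I W).Structure N] :
    (forbidden C).OmittedIn N ↔
      ∀ b : Fin m → N, RelMap (guardSym L I W m) b ∧ ∃ θ ∈ C, θ.Realize b := by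
  simp only [FormulaSet.OmittedIn, not_exists]
  refine forall_congr' fun b => ⟨fun h => ?_, ?_⟩
  · by_contra! h'
    refine h ?_
    rintro _ ⟨θ, hθ, rfl⟩
    exact Formula.realize_imp.2 fun hg => Formula.realize_not.2
      (h' ((realize_guardFormula b).1 hg) θ hθ)
  · rintro ⟨hg, θ, hθ, hb⟩ h
    exact Formula.realize_not.1 (Formula.realize_imp.1 (h _ ⟨θ, hθ, rfl⟩)
      ((realize_guardFormula b).2 hg)) hb

theorem EC_forbiddenTypes_iff [Nonempty I] {N : Type u} [(presLang L I W).Structure N] :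
    EC ∅ (forbiddenTypes rep enum) N ↔
      (∀ m (b : Fin m → N), RelMap (guardSym L I W m) b) ∧ IsPresented rep enum N := by
  rw [← holdsIn_clauses_iff]
  simp only [EC, forbiddenTypes, forall_mem_range, Sigma.forall, Subtype.forall,
    omittedIn_forbidden_iff, HoldsIn]
  constructor
  · rintro ⟨-, h⟩
    obtain ⟨i⟩ := ‹Nonempty I›
    exact ⟨fun m b => (h m _ (tautology_mem_clauses m (Sum.inl i)) b).1,
      fun m C hC b => (h m C hC b).2⟩
  · rintro ⟨h₁, h₂⟩
    exact ⟨inferInstance, fun m C hC b => ⟨h₁ m b, h₂ m C hC b⟩⟩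

/-- The omitted types are quantifier-free, so omitting them passes to substructures. -/
theorem EC_forbiddenTypes_substructure {N : Type u} [(presLang L I W).Structure N]
    (h : EC ∅ (forbiddenTypes rep enum) N) (M : (presLang L I W).Substructure N) :
    EC ∅ (forbiddenTypes rep enum) M := by
  refine ⟨inferInstance, ?_⟩
  rintro _ ⟨⟨m, C, hC⟩, rfl⟩ ⟨a, ha⟩
  refine h.2 _ ⟨⟨m, C, hC⟩, rfl⟩ ⟨M.subtype ∘ a, ?_⟩
  rintro _ ⟨θ, hθ, rfl⟩
  have hqf : ((guardFormula L I W m).imp θ.not).IsQF :=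
    isQF_rel.imp (isQF_of_mem_clauses hC hθ).not
  have := (hqf.realize_embedding M.subtype).2 (ha _ ⟨θ, hθ, rfl⟩)
  rw [Subsingleton.elim (M.subtype ∘ default) default] at this
  exact this

theorem isTypeOver_of_mem_forbiddenTypes {p : FormulaSet (presLang L I W)}
    (hp : p ∈ forbiddenTypes rep enum) : p.IsTypeOver ∅ := by
  obtain ⟨⟨m, C, hC⟩, rfl⟩ := hp
  let _ : (presLang L I W).Structure PUnit.{u + 1} :=
    { funMap := fun _ _ => PUnit.unit, RelMap := fun _ _ => False }
  refine ⟨Theory.ModelType.of ∅ PUnit.{u + 1}, fun _ => PUnit.unit, ?_⟩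
  rintro _ ⟨θ, -, rfl⟩
  exact Formula.realize_imp.2 fun h => ((realize_guardFormula _).1 h).elim

/-! ### Counting symbols and types -/

theorem embedsIn_functions {X : Type u} (h : L.card ≤ #X) : EmbedsIn X (Σ n, L.Functions n) :=
  (EmbedsIn.of_mk_le h).of_injective Sum.inl Sum.inl_injective

theorem embedsIn_relations {X : Type u} (h : L.card ≤ #X) : EmbedsIn X (Σ n, L.Relations n) :=
  (EmbedsIn.of_mk_le h).of_injective Sum.inr Sum.inr_injective

theorem card_presLang [Infinite I] (hL : L.card ≤ #I) :
    (presLang L I W).card = #(I ⊕ W) := by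
  have hI : EmbedsIn (I ⊕ W) I := ⟨⟨Sum.inl, Sum.inl_injective⟩⟩
  have hW : EmbedsIn (I ⊕ W) W := ⟨⟨Sum.inr, Sum.inr_injective⟩⟩
  have hL' : L.card ≤ #(I ⊕ W) := hL.trans hI
  have hs : ∀ m, EmbedsIn (I ⊕ W) (Subtuple m) := fun m => .of_countable
  refine le_antisymm ?_ ?_
  · refine (EmbedsIn.sum (.sigma (A := ℕ) .of_countable fun m => ?_)
      (.sigma (A := ℕ) .of_countable fun m => ?_) : EmbedsIn (I ⊕ W) (presLang L I W).Symbols)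
    · exact ((embedsIn_functions hL').of_injective _ sigma_mk_injective).sum
        (hI.sum ((hs m).prod hI))
    · exact ((embedsIn_relations hL').of_injective _ sigma_mk_injective).sum
        (((hs m).prod hW).sum .of_countable)
  · refine mk_le_of_injective (f := fun x : I ⊕ W => (x.elim (fun i => Sum.inl ⟨0, hullSym L W i 0⟩)
      fun w => Sum.inr ⟨0, typeSym L I ⟨0, Fin.elim0⟩ w⟩ : (presLang L I W).Symbols)) ?_
    rintro (i | w) (j | v) h
    · exact congrArg _ (Sum.inl.inj (Sum.inr.inj (eq_of_heq (Sigma.mk.inj (Sum.inl.inj h)).2)))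
    · cases h
    · cases h
    · exact congrArg _ (Prod.mk.inj
        (Sum.inl.inj (Sum.inr.inj (eq_of_heq (Sigma.mk.inj (Sum.inr.inj h)).2)))).2

theorem mk_forbiddenTypes [Infinite I] (hL : L.card ≤ #I) :
    #(forbiddenTypes rep enum) = #(I ⊕ W) := by
  refine le_antisymm ?_ ?_
  · have hI : EmbedsIn (I ⊕ W) I := ⟨⟨Sum.inl, Sum.inl_injective⟩⟩
    have hW : EmbedsIn (I ⊕ W) W := ⟨⟨Sum.inr, Sum.inr_injective⟩⟩
    have hL' : L.card ≤ #(I ⊕ W) := hL.trans hI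
    have hbig : ∀ w, EmbedsIn (I ⊕ W) (rep w).big := fun w =>
      hI.of_injective (enum w) (enum w).injective
    have hs : ∀ m, EmbedsIn (I ⊕ W) (Subtuple m) := fun m => .of_countable
    have hfun : ∀ n, EmbedsIn (I ⊕ W) (L.Functions n) := fun n =>
      (embedsIn_functions hL').of_injective _ sigma_mk_injective
    have hrel : ∀ n, EmbedsIn (I ⊕ W) (L.Relations n) := fun n =>
      (embedsIn_relations hL').of_injective _ sigma_mk_injective
    refine (EmbedsIn.range (EmbedsIn.sigma (A := ℕ) .of_countable fun m => ?_) _ :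
      EmbedsIn (I ⊕ W) _)
    refine .union (.union (.union (.union (.union (.union (.union (.union (.union ?_ ?_) ?_) ?_) ?_)
      ?_) ?_) ?_) ?_) ?_
    · exact (hI.sum hW).range _
    · exact EmbedsIn.of_countable.range _
    · exact (hs m).range _
    · exact ((hs m).sigma fun _ => hW.sigma fun w =>
        ((hbig w).prod (hbig w)).of_injective _ Subtype.val_injective).range _
    · exact ((hs m).sigma fun _ => hW.sigma fun w => EmbedsIn.of_countable.sigma fun n =>
        (hfun n).prod ((hbig w).finArrow n)).range _
    · exact ((hs m).sigma fun _ => hW.sigma fun w => EmbedsIn.of_countable.sigma fun n =>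
        (hrel n).prod ((hbig w).finArrow n)).range _
    · exact ((hs m).prod hI).range _
    · exact ((hs m).prod hI).range _
    · exact ((hs m).sigma fun _ => hW.sigma fun w =>
        (hbig w).of_injective _ Subtype.val_injective).range _
    · exact ((hs m).prod (hW.prod hI)).range _
  · refine mk_le_of_injective (f := fun x : I ⊕ W =>
      (⟨_, ⟨0, {tautology 0 x}, tautology_mem_clauses 0 x⟩, rfl⟩ : forbiddenTypes rep enum))
      fun x y h => ?_
    have h' : (fun θ => (guardFormula L I W 0).imp θ.not) '' {tautology 0 x} =
        (fun θ => (guardFormula L I W 0).imp θ.not) '' {tautology 0 y} :=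
      eq_of_heq (Sigma.mk.inj (congrArg Subtype.val h)).2
    rw [image_singleton, image_singleton, singleton_eq_singleton_iff] at h'
    injection h' with _ _ h'
    injection h' with _ h'
    exact tautology_injective 0 h'

end

end AEC

namespace AEC

open Structure Set Substructure

variable {L : Language.{u, u}} {K : AEC L} {κ : Cardinal.{u}} {I W : Type u}
  {rep : W → K.StrongPair κ} {enum : ∀ w, (rep w).big ≃ I}

/-! ### Reducts of the models omitting the types belong to the class -/

section Soundness

variable {N : Type u} [L.Structure N] [(presLang L I W).Structure N]
  [(LHom.sumInl : L →ᴸ presLang L I W).IsExpansionOn N]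

/-- The adapted enumeration of the hull of `b`, as an embedding of the pair that it names. -/
def IsPresented.embedding (h : IsPresented rep enum N) {m : ℕ} (s : Subtuple m) (w : W)
    (b : Fin m → N) (hb : RelMap (typeSym L I s w) b) : (rep w).big ↪[L] N where
  toFun x := funMap (pairSym L W s (enum w x)) b
  inj' x y hxy := by
    by_contra hne
    exact h.pair_ne s w x y hne b hb hxy
  map_fun' f t := by
    rw [← h.pair_fun s w f t b hb, LHom.map_onFunction]
    rfl
  map_rel' r t := by
    rw [← h.pair_rel s w r t b hb, LHom.map_onRelation]
    rfl

/-- The hulls of tuples are `L`-substructures, and are `≤_K`-increasing. -/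
theorem IsPresented.exists_hull (h : IsPresented rep enum N) :
    ∃ S : ∀ {m}, (Fin m → N) → L.Substructure N,
      (∀ {m} (b : Fin m → N), (S b : Set N) = range fun i : I => funMap (hullSym L W i m) b) ∧
      ∀ {m} (b : Fin m → N) (s : Subtuple m), K.Le (S (b ∘ s.2)) (S b) := by
  have hrange : ∀ {m} (b : Fin m → N) (s : Subtuple m) w (hb : RelMap (typeSym L I s w) b),
      ((h.embedding s w b hb).toHom.range : Set N) =
        range fun i : I => funMap (hullSym L W i m) b := by
    intro m b s w hb
    ext y
    constructor
    · rintro ⟨x, rfl⟩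
      obtain ⟨j, hj⟩ := h.pair_mem_hull s (enum w x) b
      exact ⟨j, hj.symm⟩
    · rintro ⟨j, rfl⟩
      obtain ⟨i, hi⟩ := h.hull_mem_pair s j b
      exact ⟨(enum w).symm i, by
        change funMap (pairSym L W s (enum w ((enum w).symm i))) b = _
        rw [_root_.Equiv.apply_symm_apply, ← hi]⟩
  have hS : ∀ {m} (b : Fin m → N), ∃ S : L.Substructure N,
      (S : Set N) = range fun i : I => funMap (hullSym L W i m) b := fun {m} b => by
    obtain ⟨w, hw⟩ := h.exists_type ⟨m, id⟩ b
    exact ⟨_, hrange b _ w hw⟩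
  choose S hS using @hS
  refine ⟨@S, @hS, fun {m} b s => ?_⟩
  obtain ⟨w, hw⟩ := h.exists_type s b
  have hle := (le_range_iff (h.embedding s w b hw)).2 (rep w).strong
  convert hle using 1
  · apply SetLike.coe_injective
    rw [hS]
    ext y
    constructor
    · rintro ⟨j, rfl⟩
      obtain ⟨x, hx⟩ := h.hull_mem_small s w j b hw
      exact ⟨x, x.2, hx.symm⟩
    · rintro ⟨x, hx, rfl⟩
      obtain ⟨j, hj⟩ := h.small_mem_hull s w ⟨x, hx⟩ b hw
      exact ⟨j, hj.symm⟩
  · apply SetLike.coe_injective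
    rw [hS, hrange]

/-- A substructure closed under hulls is the union of the hulls of its finite subsets, hence is a
`K`-substructure. -/
theorem IsPresented.strong_of_closed (h : IsPresented rep enum N) (U : L.Substructure N)
    (hU : ∀ {m} (b : Fin m → N), (∀ k, b k ∈ U) → ∀ i : I, funMap (hullSym L W i m) b ∈ U) :
    K.strong U := by
  obtain ⟨S, hS, hle⟩ := h.exists_hull
  let tup : (s : Finset N) → Fin s.card → N := fun s k => s.equivFin.symm k
  let D : Finset N → L.Substructure N := fun s => S (tup s)
  have hD : ∀ s t, s ⊆ t → K.Le (D s) (D t) := fun s t hst => by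
    have : tup s = tup t ∘ fun k => t.equivFin ⟨tup s k, hst (s.equivFin.symm k).2⟩ := by
      funext k
      simp [tup]
    change K.Le (S (tup s)) (S (tup t))
    rw [this]
    exact hle (tup t) ⟨_, _⟩
  have hm : Monotone D := fun s t hst => (hD s t hst).1
  have hmem : ∀ x, x ∈ D {x} := fun x => by
    obtain ⟨i, hi⟩ := h.mem_hull (({x} : Finset N).equivFin ⟨x, by simp⟩) (tup {x})
    have hx : tup {x} (({x} : Finset N).equivFin ⟨x, by simp⟩) = x := by simp [tup]
    have : x ∈ (S (tup {x}) : Set N) := by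
      rw [hS]
      exact ⟨i, hi.symm.trans hx⟩
    exact this
  have hU' : finUnion D hm U = U := by
    refine le_antisymm (fun x hx => ?_) fun x hx =>
      mem_finUnion.2 ⟨{x}, by simpa using hx, hmem x⟩
    obtain ⟨s, hs, hx⟩ := mem_finUnion.1 hx
    have hx' : x ∈ (S (tup s) : Set N) := hx
    rw [hS] at hx'
    obtain ⟨i, rfl⟩ := hx'
    exact hU _ (fun k => hs (s.equivFin.symm k).2) i
  have htop : finUnion D hm univ = ⊤ :=
    top_le_iff.1 fun x _ => mem_finUnion.2 ⟨{x}, subset_univ _, hmem x⟩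
  rw [← le_top_iff, ← hU', ← htop]
  exact finUnion_le_finUnion hm hD (subset_univ _)

theorem IsPresented.mem_and_le (h : IsPresented rep enum N) : K.mem N ∧ κ ≤ #N := by
  refine ⟨(K.mem_of_strong _ (h.strong_of_closed ⊤ fun _ _ _ => trivial)).2, ?_⟩
  -- The empty tuple already has a hull of size `κ`.
  obtain ⟨w, hw⟩ := h.exists_type ⟨0, Fin.elim0⟩ (Fin.elim0 : Fin 0 → N)
  rw [← (rep w).card_big]
  exact mk_le_of_injective (h.embedding _ w _ hw).injective

end Soundness

/-! ### Expanding a pair of members of the class -/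

/-- Hulls are taken from `exists_finset_system`, so they depend on a tuple only through the set of
its entries; this makes them monotone in subtuples. -/
theorem exists_expansion [Infinite I] (hI : #I = K.LS) {rep : W → K.StrongPair K.LS}
    (hrep : ∀ p, ∃ w, (rep w).Iso p) (enum : ∀ w, (rep w).big ≃ I)
    (N : Type u) [L.Structure N] (M : L.Substructure N) (hM : K.strong M) (hcard : K.LS ≤ #M) :
    ∃ (_ : (presLang L I W).Structure N)
      (_ : (LHom.sumInl : L →ᴸ presLang L I W).IsExpansionOn N)
      (M' : (presLang L I W).Substructure N),
      LHom.sumInl.substructureReduct M' = M ∧ EC ∅ (forbiddenTypes rep enum) M' ∧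
        EC ∅ (forbiddenTypes rep enum) N := by
  classical
  obtain ⟨D, hmono, hsub, hstrong, hDcard, hDM⟩ := exists_finset_system hM hcard
  let H : ∀ {m}, (Fin m → N) → L.Substructure N := fun b => D (Finset.univ.image b)
  have hHM : ∀ {m} (b : Fin m → N), (∀ k, b k ∈ M) → H b ≤ M := fun b hb =>
    hDM _ (by simpa [range_subset_iff] using hb)
  have hHmono : ∀ {m} (s : Subtuple m) (b : Fin m → N), H (b ∘ s.2) ≤ H b := fun s b =>
    hmono (by
      rw [← Finset.image_image]
      exact Finset.image_subset_image (Finset.subset_univ _))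
  have e : ∀ {m} (b : Fin m → N), Nonempty (I ≃ H b) := fun b => by
    rw [← Cardinal.eq, hI]
    exact (hDcard _).symm
  replace e := fun {m} (b : Fin m → N) => (e b).some
  let pair : ∀ {m}, Subtuple m → (Fin m → N) → K.StrongPair K.LS := fun s b =>
    { big := H b
      small := (H (b ∘ s.2)).comap (H b).subtype.toHom
      strong := (K.coherence _ _ (hstrong _) (hstrong _) (hHmono s b)).2
      card_big := hDcard _
      card_small := by
        rw [mk_congr ((H b).subtype.substructureEquivMap _).toEquiv,
          map_subtype_comap (hHmono s b)]
        exact hDcard _ }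
  choose w g hg using fun {m} (s : Subtuple m) (b : Fin m → N) => hrep (pair s b)
  let F : ∀ {m}, Subtuple m → I → (Fin m → N) → N := fun s i b =>
    (g s b ((enum (w s b)).symm i) : H b)
  let str : (witnessLang I W).Structure N :=
    { funMap := fun {m} f b => f.elim (fun i => (e b i : N)) fun q => F q.1 q.2 b
      RelMap := fun {m} r b => r.elim (fun q => q.2 = w q.1 b) fun _ => True }
  have hhull : ∀ {m} (i : I) (b : Fin m → N), funMap (hullSym L W i m) b = e b i :=
    fun _ _ => rfl
  have hpair : ∀ {m} (s : Subtuple m) (b : Fin m → N) (x : (rep (w s b)).big),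
      funMap (pairSym L W s (enum (w s b) x)) b = (g s b x : H b) := fun s b x => by
    change ((g s b ((enum (w s b)).symm (enum (w s b) x)) : H b) : N) = _
    rw [_root_.Equiv.symm_apply_apply]
  have htype : ∀ {m} (s : Subtuple m) (v : W) (b : Fin m → N),
      RelMap (typeSym L I s v) b ↔ v = w s b := fun _ _ _ => Iff.rfl
  have hN : EC ∅ (forbiddenTypes rep enum) N := by
    refine EC_forbiddenTypes_iff.2 ⟨fun _ _ => trivial, ?_⟩
    constructor
    · intro m k b
      have hk : b k ∈ H b := hsub _ (by simp)
      exact ⟨(e b).symm ⟨b k, hk⟩, by rw [hhull, _root_.Equiv.apply_symm_apply]⟩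
    · exact fun s b => ⟨w s b, rfl⟩
    · intro m s v x y hxy b hb
      obtain rfl := (htype s v b).1 hb
      rw [hpair, hpair]
      exact fun h => hxy ((g s b).injective (Subtype.ext h))
    · intro m s v n f t b hb
      obtain rfl := (htype s v b).1 hb
      simp only [hpair, LHom.map_onFunction]
      rw [(g s b).map_fun]
      rfl
    · intro m s v n r t b hb
      obtain rfl := (htype s v b).1 hb
      simp only [hpair, LHom.map_onRelation]
      exact (g s b).map_rel r t
    · intro m s i b
      refine ⟨(e b).symm (g s b ((enum (w s b)).symm i)), ?_⟩
      rw [hhull, _root_.Equiv.apply_symm_apply]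
      rfl
    · intro m s j b
      refine ⟨enum _ ((g s b).symm (e b j)), ?_⟩
      rw [hpair, Language.Equiv.apply_symm_apply, hhull]
    · intro m s v x b hb
      obtain rfl := (htype s v b).1 hb
      have hx : g s b x ∈ (pair s b).small := by
        rw [← hg]
        exact mem_map_of_mem _ x.2
      refine ⟨(e (b ∘ s.2)).symm ⟨_, hx⟩, ?_⟩
      rw [hpair, hhull, _root_.Equiv.apply_symm_apply]
      rfl
    · intro m s v j b hb
      obtain rfl := (htype s v b).1 hb
      have hj : (⟨e (b ∘ s.2) j, hHmono s b (e (b ∘ s.2) j).2⟩ : H b) ∈ (pair s b).small :=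
        (e (b ∘ s.2) j).2
      rw [← hg] at hj
      obtain ⟨x, hx, hxj⟩ := hj
      refine ⟨⟨x, hx⟩, ?_⟩
      rw [hpair, hhull]
      exact congrArg Subtype.val hxj.symm
  let M' : (presLang L I W).Substructure N :=
    { carrier := M
      fun_mem := by
        rintro m (f | i | q) b hb
        · exact M.fun_mem f b hb
        · exact hHM b hb (e b i).2
        · exact hHM b hb (g q.1 b ((enum (w q.1 b)).symm q.2)).2 }
  exact ⟨inferInstance, inferInstance, M', rfl, EC_forbiddenTypes_substructure hN M', hN⟩

end AEC

end FirstOrder.Language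

theorem theorem4p1 (L : FirstOrder.Language.{u, u}) (K : FirstOrder.Language.AEC L)
    (χ : Cardinal.{u + 1}) (hχ : χ = Cardinal.lift.{u + 1} K.LS + K.I₂ K.LS) :
    ∃ (L' : FirstOrder.Language.{u, u}) (ι : L →ᴸ L') (T : L'.Theory)
      (Γ : Set (FirstOrder.Language.FormulaSet L')),
      ι.Injective ∧
      Cardinal.lift.{u + 1} L'.card = χ ∧
      (∀ p ∈ Γ, p.IsTypeOver T) ∧
      Cardinal.lift.{u + 1} #Γ = χ ∧
      (∀ (M : Type u) [L.Structure M],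
        (K.mem M ∧ K.LS ≤ #M) ↔ FirstOrder.Language.PC ι T Γ M) ∧
      (∀ (N : Type u) [L.Structure N] [L'.Structure N] [ι.IsExpansionOn N]
        (M : L'.Substructure N),
        FirstOrder.Language.EC T Γ M → FirstOrder.Language.EC T Γ N →
          K.strong (ι.substructureReduct M)) ∧
      (∀ (N : Type u) [L.Structure N] (M : L.Substructure N),
        K.strong M → K.LS ≤ #M →
          ∃ (_ : L'.Structure N) (_ : ι.IsExpansionOn N) (M' : L'.Substructure N),
            ι.substructureReduct M' = M ∧
            FirstOrder.Language.EC T Γ M' ∧ FirstOrder.Language.EC T Γ N) := by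

  classical
  obtain ⟨I, hI⟩ : ∃ I : Type u, #I = K.LS := ⟨K.LS.out, mk_out _⟩
  have hLS := K.isLSBound_LS
  have : Infinite I := infinite_iff.2 (hI ▸ hLS.1)
  have hL : L.card ≤ #I := hI ▸ hLS.2.1
  obtain ⟨W, rep, hW, hrep⟩ := K.exists_representatives K.LS
  have enum : ∀ w, (rep w).big ≃ I := fun w =>
    (Cardinal.eq.1 ((rep w).card_big.trans hI.symm)).some
  have hχ' : Cardinal.lift.{u + 1} #(I ⊕ W) = χ := by
    rw [hχ, mk_sum, Cardinal.lift_id, Cardinal.lift_id, Cardinal.lift_add, hI, hW]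
  refine ⟨FirstOrder.Language.presLang L I W, FirstOrder.Language.LHom.sumInl, ∅,
    FirstOrder.Language.AEC.forbiddenTypes rep enum, FirstOrder.Language.LHom.sumInl_injective,
    ?_, fun p hp => FirstOrder.Language.AEC.isTypeOver_of_mem_forbiddenTypes hp, ?_, ?_, ?_, ?_⟩
  · rw [FirstOrder.Language.AEC.card_presLang hL, hχ']
  · rw [FirstOrder.Language.AEC.mk_forbiddenTypes hL, hχ']
  · intro M _
    constructor
    · rintro ⟨hM, hcard⟩
      obtain ⟨S, hexp, -, -, -, hEC⟩ := FirstOrder.Language.AEC.exists_expansion hI hrep enum M ⊤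
        (K.strong_refl M hM) (hcard.trans_eq mk_univ.symm)
      exact ⟨S, hexp, hEC⟩
    · rintro ⟨S, hexp, hEC⟩
      exact (FirstOrder.Language.AEC.EC_forbiddenTypes_iff.1 hEC).2.mem_and_le
  · intro N _ _ _ M _ hN
    exact (FirstOrder.Language.AEC.EC_forbiddenTypes_iff.1 hN).2.strong_of_closed _
      fun b hb i => M.fun_mem (FirstOrder.Language.hullSym L W i _) b hb
  · intro N _ M hM hcard
    exact FirstOrder.Language.AEC.exists_expansion hI hrep enum N M hM hcard
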